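/- Let $C=\bigwedge_j c_j$ be a read-5 monotone CNF formula over a finite set of variables: each clause $c_j=\bigvee_i x_{j,i}$ is a disjunction of at least one variable, all literals being positive (variables within a clause need not be distinct), and each variable appears in at most $5$ clauses. Let $x$ be a variable, let $\mathbb{P}_C$ be the uniform distribution on the satisfying assignments of $C$, and put $R(C,x)=\mathbb{P}_C(x=0)/\mathbb{P}_C(x=1)$. For a monotone formula $C$ and a variable $x$, enumerate the clauses of $C$ containing $x$ as $c_1,\dots,c_d$ with $d=d_x(C)$; let $w_j=|c_j|-1$, where $|c_j|$ is the number of distinct variables of $c_j$, and let $x_{j,1},\dots,x_{j,w_j}$ be an enumeration of the distinct variables of $c_j$ other than $x$. Let $C_{j,i}$ be obtained from $C$ by removing the clauses $c_1,\dots,c_j$, deleting $x$ from the clauses $c_{j+1},\dots,c_d$, and then deleting $x_{j,1},\dots,x_{j,i-1}$ from all the clauses. (Repeated clauses count as separate clauses, and a clause may become empty.) With $L_j=\max(0,\,L-\lceil\log_4(w_j+1)\rceil)$, define for every integer $L\ge 0$ recursively $$R(C,x,L)=\begin{cases}0, & w_j=0\text{ for some }j,\\ 1, & \text{otherwise, if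 } d=0\text{ or }L=0,\\ \displaystyle\prod_{j=1}^{d}\left(1-\prod_{i=1}^{w_j}\frac{R(C_{j,i},x_{j,i},L_j)}{1+R(C_{j,i},x_{j,i},L_j)}\right), & \text{otherwise.}\end{cases}$$ Then, for $\alpha=0.981$, every read-5 monotone CNF formula $C$, every variable $x$, every choice of the enumerations in the recursion (one for each pair of a formula and a variable), and every integer $L\ge 0$, $$|R(C,x,L)-R(C,x)|\le 5\sqrt6\,\alpha^{L}.$$ -/

import Mathlib

noncomputable section

namespace MonCNF

/-- A monotone clause `x₁ ∨ ⋯ ∨ xₖ`: the variables need not be distinct. -/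
abbrev Clause (V : Type*) := Multiset V

/-- A monotone formula `c₁ ∧ ⋯ ∧ cₘ`. Repeated clauses count as separate occurrences. -/
abbrev Formula (V : Type*) := Multiset (Clause V)

variable {V : Type*} [DecidableEq V]

/-- `|c|`: the number of distinct variables in the clause `c`. -/
def Clause.size (c : Clause V) : ℕ := c.toFinset.card

/-- `c - x`: the occurrences of `x` in the clause `c` are pinned to `0`. -/
def Clause.pin (c : Clause V) (x : V) : Clause V := c.filter (fun y => y ≠ x)

/-- `C - x`: the variable `x` is pinned to `0` in the entire formula. -/
def Formula.pin (C : Formula V) (x : V) : Formula V := C.map (fun c => Clause.pin c x)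

/-- `d_x(C)`: the number of clauses of `C` in which `x` appears. -/
def Formula.occ (C : Formula V) (x : V) : ℕ := C.countP (fun c => x ∈ c)

/-- `C` is a read-`d` monotone CNF formula: every clause is a disjunction of at least one
variable, and every variable appears in at most `d` clauses. -/
def IsReadMonCNF (d : ℕ) (C : Formula V) : Prop :=
  (∀ c ∈ C, c ≠ 0) ∧ ∀ x : V, Formula.occ C x ≤ d

/-! ### Marginal probabilities -/

section Marginals

variable [Fintype V]

open Classical in
/-- `X(C)`: the satisfying assignments of `C` (`true` is `1`, `false` is `0`). -/
def sat (C : Formula V) : Finset (V → Bool) :=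
  Finset.univ.filter (fun σ => ∀ c ∈ C, ∃ y ∈ c, σ y = true)

/-- `ℙ_C(x = b)` for an assignment drawn uniformly from `X(C)`. -/
def marginal (C : Formula V) (x : V) (b : Bool) : ℝ :=
  (((sat C).filter (fun σ => σ x = b)).card : ℝ) / ((sat C).card : ℝ)

/-- `R(C, x) = ℙ_C(x = 0) / ℙ_C(x = 1)`. -/
def ratio (C : Formula V) (x : V) : ℝ := marginal C x false / marginal C x true

/-- The denominator of `R(C, x)` is positive for a formula without an empty clause. -/
theorem marginal_true_pos (C : Formula V) (hC : ∀ c ∈ C, c ≠ 0) (x : V) :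
    0 < marginal C x true := by
  have h : (fun _ => true : V → Bool) ∈ sat C := by
    simp only [sat, Finset.mem_filter, Finset.mem_univ, true_and]
    intro c hc
    obtain ⟨y, hy⟩ := Multiset.exists_mem_of_ne_zero (hC c hc)
    exact ⟨y, hy, trivial⟩
  have h1 : 0 < (sat C).card := Finset.card_pos.mpr ⟨_, h⟩
  have h2 : 0 < ((sat C).filter (fun σ => σ x = true)).card :=
    Finset.card_pos.mpr ⟨_, Finset.mem_filter.mpr ⟨h, rfl⟩⟩
  unfold marginal
  positivity

end Marginals

/-! ### The truncated recursion -/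

/-- A choice, for all `C` and `x`, of an enumeration `c₁, …, c_d` of the clauses of `C`
containing `x` and, for each `j`, of an enumeration `x_{j,1}, …, x_{j,w_j}` without repetition
of the variables of `c_j - x`. Indices start at `0`. -/
structure Enumeration (V : Type*) [DecidableEq V] where
  clauses : Formula V → V → List (Clause V)
  coe_clauses : ∀ (C : Formula V) (x : V),
    (clauses C x : Multiset (Clause V)) = C.filter (fun c => x ∈ c)
  vars : ∀ (C : Formula V) (x : V), Fin (clauses C x).length → List V
  vars_nodup : ∀ (C : Formula V) (x : V) (j : Fin (clauses C x).length), (vars C x j).Nodup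
  mem_vars : ∀ (C : Formula V) (x : V) (j : Fin (clauses C x).length) (y : V),
    y ∈ vars C x j ↔ y ∈ Clause.pin ((clauses C x).get j) x

instance : Nonempty (Enumeration V) :=
  ⟨{ clauses := fun C x => (C.filter (fun c => x ∈ c)).toList
     coe_clauses := fun C x => Multiset.coe_toList _
     vars := fun C x j => (Clause.pin ((C.filter (fun c => x ∈ c)).toList.get j) x).toFinset.toList
     vars_nodup := fun C x j => Finset.nodup_toList _
     mem_vars := fun C x j y => by rw [Finset.mem_toList, Multiset.mem_toFinset] }⟩

namespace Enumeration

variable (E : Enumeration V) (C : Formula V) (x : V)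

/-- `w_j = |c_j| - 1`, the number of variables of `c_j` other than `x`. -/
def width (j : Fin (E.clauses C x).length) : ℕ := Clause.size ((E.clauses C x).get j) - 1

/-- `C_j = (C - ∑_{k ≠ j} c_k) + ∑_{k > j} (c_k - x)`. -/
def sub (j : Fin (E.clauses C x).length) : Formula V :=
  (C - ((E.clauses C x).eraseIdx j : Multiset (Clause V)))
    + (((E.clauses C x).drop (j + 1)).map (fun c => Clause.pin c x) : Multiset (Clause V))

/-- `C_{j,i} = C_j - c_j - ∑_{k < i} x_{j,k}`. -/
def subsub (j : Fin (E.clauses C x).length) (i : Fin (E.vars C x j).length) : Formula V :=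
  ((E.vars C x j).take i).foldl Formula.pin (E.sub C x j - {(E.clauses C x).get j})

open Classical in
/-- `R(C, x, L)`: the recursion truncated at depth `L`. Here `Nat.clog 4 (w + 1)` is
`⌈log₄ (w + 1)⌉`, and the subtraction of natural numbers is `max (0, L - ⌈log₄ (w + 1)⌉)`. -/
def truncRatio (C : Formula V) (x : V) (L : ℕ) : ℝ :=
  if h : ∃ j, E.width C x j = 0 then 0
  else if h' : Formula.occ C x = 0 ∨ L = 0 then 1
  else
    ∏ j : Fin (E.clauses C x).length,
      (1 - ∏ i : Fin (E.vars C x j).length,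
        (truncRatio (E.subsub C x j i) ((E.vars C x j).get i)
            (L - Nat.clog 4 (E.width C x j + 1)) /
          (1 + truncRatio (E.subsub C x j i) ((E.vars C x j).get i)
            (L - Nat.clog 4 (E.width C x j + 1)))))
termination_by L
decreasing_by
  all_goals
    have hw : E.width C x j ≠ 0 := fun h0 => h ⟨j, h0⟩
    have hc : 0 < Nat.clog 4 (E.width C x j + 1) := Nat.clog_pos (by norm_num) (by omega)
    have hL : L ≠ 0 := fun h0 => h' (Or.inr h0)
    omega

end Enumeration

end MonCNF

end

namespace MonCNF

/-! ### Analytic estimates -/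

section Analysis

open Real Finset

/-! The proof is correlation decay in well-chosen coordinates. Without truncation the recursion is
exact (`ratio_recursion`): the ratio is a quotient of numbers of satisfying assignments, which
telescopes over the clauses containing `x` and then, by the chain rule, over the variables of each
clause.

Measure a ratio by `u = arsinh √R` and the failure probability `P` of a clause by `v = artanh √P`.
Then `R / (1 + R) = tanh² u` and `1 - P = 1 / cosh² v`, so the two layers of the recursion become `v
= artanh (∏ tanh uᵢ)` and `u = arsinh (∏ 1 / cosh vⱼ)`. In the sup norm the first map is Lipschitz
with constant `0.981 ^ (w - 1)` (`artanh_prod_tanh_lipschitz`); this uses `R ≤ 1`, which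
monotonicity of the formula provides. The second has constant `0.981` for at most four clauses
(`arsinh_prod_lipschitz`). A recursive call through a clause of width `w` thus gains `0.981 ^ w`,
while the depth drops by `⌈log₄ (w + 1)⌉ ≤ w`; induction on the depth gives the error `0.981 ^ L` in
the coordinate `u` (`ratioCoord_error`).

Four clauses suffice below the root, because a variable reached through a clause has lost that
clause. The root may have five; there the last layer is bounded crudely (`abs_prod_one_sub_sub_le`),
which costs only a constant factor. -/

theorem hasDerivAt_tanh (x : ℝ) : HasDerivAt tanh (1 - tanh x ^ 2) x := by
  have h := (hasDerivAt_sinh x).div (hasDerivAt_cosh x) (cosh_pos x).ne'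
  have e : (sinh / cosh : ℝ → ℝ) = tanh := by
    funext y
    simp [tanh_eq_sinh_div_cosh]
  rw [e] at h
  have e' : (cosh x * cosh x - sinh x * sinh x) / cosh x ^ 2 = 1 - tanh x ^ 2 := by
    rw [tanh_eq_sinh_div_cosh]
    have := (cosh_pos x).ne'
    field_simp
  rwa [e'] at h

theorem hasDerivAt_artanh {x : ℝ} (hx : x ∈ Set.Ioo (-1 : ℝ) 1) :
    HasDerivAt artanh (1 - x ^ 2)⁻¹ x := by
  have h1 : 0 < 1 + x := by linarith [hx.1]
  have h2 : 0 < 1 - x := by linarith [hx.2]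
  have h : HasDerivAt (fun y : ℝ => 1 / 2 * (log (1 + y) - log (1 - y)))
      (1 / 2 * (1 / (1 + x) - (-1) / (1 - x))) x :=
    ((((hasDerivAt_id x).const_add 1).log h1.ne').sub
      (((hasDerivAt_id x).const_sub 1).log h2.ne')).const_mul _
  have e : (1 / 2 * (1 / (1 + x) - (-1) / (1 - x))) = (1 - x ^ 2)⁻¹ := by
    have h3 : 1 - x ^ 2 ≠ 0 := by nlinarith [mul_pos h1 h2]
    field_simp
    ring
  rw [e] at h
  refine h.congr_of_eventuallyEq ?_
  filter_upwards [Ioo_mem_nhds hx.1 hx.2] with y hy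
  rw [artanh_eq_half_log ⟨hy.1.le, hy.2.le⟩,
    log_div (by linarith [hy.1]) (by linarith [hy.2])]

/-! ### Contraction across one clause -/

/-- The sum over `i`, divided by `1 - (∏ t)²`, is the sup-norm Lipschitz constant of `artanh (∏ tanh
uᵢ)` at `tᵢ = tanh uᵢ`. The bound on `2 ∏ t` is carried along because the induction for the sum
needs it. -/
theorem artanh_diff_bound_aux {ι : Type*} [DecidableEq ι] (s : Finset ι) (t : ι → ℝ)
    (h0 : ∀ i ∈ s, 0 ≤ t i) (h1 : ∀ i ∈ s, 2 * t i ≤ 0.981 * (1 + t i ^ 2))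
    (h2 : ∀ i ∈ s, t i ≤ 1) :
    0.981 * ∑ i ∈ s, (∏ j ∈ s.erase i, t j) * (1 - t i ^ 2)
        ≤ 0.981 ^ s.card * (1 - (∏ i ∈ s, t i) ^ 2) ∧
      2 * ∏ i ∈ s, t i ≤ 0.981 ^ s.card * (1 + (∏ i ∈ s, t i) ^ 2) ∧
      0 ≤ ∏ i ∈ s, t i ∧ ∏ i ∈ s, t i ≤ 1 := by
  induction s using Finset.induction_on with
  | empty => norm_num
  | insert a s ha ih =>
    obtain ⟨hD, hS, hS0, hS1⟩ := ih (fun i hi => h0 i (mem_insert_of_mem hi))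
      (fun i hi => h1 i (mem_insert_of_mem hi)) (fun i hi => h2 i (mem_insert_of_mem hi))
    have ht0 := h0 a (mem_insert_self a s)
    have ht1 := h1 a (mem_insert_self a s)
    have ht2 := h2 a (mem_insert_self a s)
    have hsum : ∑ i ∈ insert a s, (∏ j ∈ (insert a s).erase i, t j) * (1 - t i ^ 2)
        = (∏ i ∈ s, t i) * (1 - t a ^ 2)
          + t a * ∑ i ∈ s, (∏ j ∈ s.erase i, t j) * (1 - t i ^ 2) := by
      rw [sum_insert ha, erase_insert ha, mul_sum]
      congr 1
      refine sum_congr rfl fun i hi => ?_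
      have hne : a ≠ i := fun h => ha (h ▸ hi)
      rw [erase_insert_of_ne hne, prod_insert (fun h => ha (mem_of_mem_erase h))]
      ring
    rw [hsum, prod_insert ha, card_insert_of_notMem ha, pow_succ]
    set S := ∏ i ∈ s, t i
    set D := ∑ i ∈ s, (∏ j ∈ s.erase i, t j) * (1 - t i ^ 2)
    set b : ℝ := 0.981 ^ s.card
    have hb : 0 < b := by positivity
    set u := t a
    have hu2 : 0 ≤ 1 - u ^ 2 := by nlinarith
    have hS2 : 0 ≤ 1 - S ^ 2 := by nlinarith
    refine ⟨?_, ?_, mul_nonneg ht0 hS0, mul_le_one₀ ht2 hS0 hS1⟩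
    -- Rests on `2 (1 - S²u²) = (1 - S²)(1 + u²) + (1 + S²)(1 - u²)`; the next bullet uses the
    -- companion `2 (1 + S²u²) = (1 + S²)(1 + u²) + (1 - S²)(1 - u²)`.
    · have e1 := mul_le_mul_of_nonneg_left hD ht0
      have e2 := mul_le_mul_of_nonneg_left ht1 (mul_nonneg hb.le hS2)
      have e3 := mul_le_mul_of_nonneg_left hS hu2
      linear_combination e1 + e2 / 2 + (0.981 / 2) * e3
    · have e1 := mul_le_mul hS ht1 (by positivity) (by positivity)
      have e2 : 0 ≤ b * 0.981 * ((1 - S ^ 2) * (1 - u ^ 2)) := by positivity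
      linear_combination (1 / 2) * e1 + (1 / 2) * e2

theorem abs_sub_le_of_path {f f' : ℝ → ℝ} {K : ℝ} (hf : ∀ x ∈ Set.Icc (0 : ℝ) 1, HasDerivAt f (f' x) x)
    (hK : ∀ x ∈ Set.Icc (0 : ℝ) 1, |f' x| ≤ K) : |f 1 - f 0| ≤ K :=
  norm_image_sub_le_of_norm_deriv_le_segment_01' (fun x hx => (hf x hx).hasDerivWithinAt)
    (fun x hx => hK x ⟨hx.1, hx.2.le⟩)

theorem tanh_arsinh_one_sq : tanh (arsinh 1) ^ 2 = 1 / 2 := by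
  rw [tanh_arsinh, div_pow, sq_sqrt] <;> norm_num

theorem tanh_mono {x y : ℝ} (h : x ≤ y) : tanh x ≤ tanh y :=
  (monotone_of_hasDerivAt_nonneg hasDerivAt_tanh
    (fun x => by have := tanh_sq_lt_one x; simp only [Pi.zero_apply]; linarith)) h

theorem two_mul_tanh_le {u : ℝ} (h0 : 0 ≤ u) (h1 : u ≤ arsinh 1) :
    0 ≤ tanh u ∧ 2 * tanh u ≤ 0.981 * (1 + tanh u ^ 2) := by
  have h2 : 0 ≤ tanh u := by simpa using tanh_mono h0
  have h3 := tanh_mono h1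
  have h4 : tanh u ^ 2 ≤ 1 / 2 := by
    rw [← tanh_arsinh_one_sq]; exact pow_le_pow_left₀ h2 h3 2
  refine ⟨h2, ?_⟩
  have h5 : tanh u ≤ 0.7072 := by
    by_contra h; push Not at h; nlinarith
  nlinarith

/-- Mean value inequality along the segment from `u` to `u'`, which stays in the cube. Nonemptiness
keeps the product off `1`, the singularity of `artanh`. The factor `0.981` on the left replaces an
exponent `card ι - 1` on the right. -/
theorem artanh_prod_tanh_lipschitz {ι : Type*} [Fintype ι] [Nonempty ι] (u u' : ι → ℝ)
    (hu : ∀ i, u i ∈ Set.Icc 0 (arsinh 1)) (hu' : ∀ i, u' i ∈ Set.Icc 0 (arsinh 1)) {δ : ℝ}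
    (hδ : ∀ i, |u' i - u i| ≤ δ) :
    0.981 * |artanh (∏ i, tanh (u' i)) - artanh (∏ i, tanh (u i))|
      ≤ 0.981 ^ Fintype.card ι * δ := by
  classical
  set p : ℝ → ι → ℝ := fun θ i => u i + θ * (u' i - u i) with hp
  have hpm : ∀ θ ∈ Set.Icc (0 : ℝ) 1, ∀ i, p θ i ∈ Set.Icc 0 (arsinh 1) := by
    intro θ hθ i
    have := (convex_Icc (0 : ℝ) (arsinh 1)).add_smul_sub_mem (hu i) (hu' i) hθ
    simpa [hp] using this
  have hlt : ∀ θ, ∏ i, tanh (p θ i) ∈ Set.Ioo (-1 : ℝ) 1 := by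
    intro θ
    rw [Set.mem_Ioo, ← abs_lt, abs_prod]
    obtain ⟨i0⟩ := ‹Nonempty ι›
    rw [← mul_prod_erase _ _ (mem_univ i0)]
    calc _ ≤ |tanh (p θ i0)| * 1 := by
          gcongr
          exact prod_le_one (fun _ _ => abs_nonneg _) (fun i _ => (abs_tanh_lt_one _).le)
      _ < 1 := by simpa using abs_tanh_lt_one _
  have hder : ∀ θ, HasDerivAt (fun θ => artanh (∏ i, tanh (p θ i)))
      ((1 - (∏ i, tanh (p θ i)) ^ 2)⁻¹ *
        ∑ i, (∏ j ∈ univ.erase i, tanh (p θ j)) • ((1 - tanh (p θ i) ^ 2) * (u' i - u i))) θ := by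
    intro θ
    have h1 : ∀ i ∈ univ, HasDerivAt (fun θ => tanh (p θ i))
        ((1 - tanh (p θ i) ^ 2) * (u' i - u i)) θ := by
      intro i _
      refine HasDerivAt.comp (h := fun θ => p θ i) θ (hasDerivAt_tanh (p θ i)) ?_
      simpa [hp] using ((hasDerivAt_id θ).mul_const (u' i - u i)).const_add (u i)
    exact HasDerivAt.comp (h₂ := artanh) θ (hasDerivAt_artanh (hlt θ))
      (HasDerivAt.fun_finsetProd h1)
  have hδ0 : 0 ≤ δ := (abs_nonneg _).trans (hδ (Classical.arbitrary ι))
  have key := abs_sub_le_of_path (K := 0.981 ^ Fintype.card ι * δ / 0.981) (fun θ _ => hder θ) ?_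
  · simp only [hp, one_mul, zero_mul, add_zero, add_sub_cancel] at key
    rw [le_div_iff₀ (by norm_num)] at key
    linarith
  · intro θ hθ
    have hb := artanh_diff_bound_aux univ (fun i => tanh (p θ i))
      (fun i _ => (two_mul_tanh_le (hpm θ hθ i).1 (hpm θ hθ i).2).1)
      (fun i _ => (two_mul_tanh_le (hpm θ hθ i).1 (hpm θ hθ i).2).2)
      (fun i _ => (tanh_lt_one _).le)
    have hS : 0 < 1 - (∏ i, tanh (p θ i)) ^ 2 := by nlinarith [(hlt θ).1, (hlt θ).2]
    rw [abs_mul, abs_of_pos (inv_pos.mpr hS), inv_mul_le_iff₀ hS]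
    have h1 : |∑ i, (∏ j ∈ univ.erase i, tanh (p θ j)) • ((1 - tanh (p θ i) ^ 2) * (u' i - u i))|
        ≤ δ * ∑ i, (∏ j ∈ univ.erase i, tanh (p θ j)) * (1 - tanh (p θ i) ^ 2) := by
      rw [mul_sum]
      refine (abs_sum_le_sum_abs _ _).trans (sum_le_sum fun i _ => ?_)
      have hq : 0 ≤ (∏ j ∈ univ.erase i, tanh (p θ j)) * (1 - tanh (p θ i) ^ 2) :=
        mul_nonneg (prod_nonneg fun j _ => (two_mul_tanh_le (hpm θ hθ j).1 (hpm θ hθ j).2).1)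
          (by have := tanh_sq_lt_one (p θ i); linarith)
      rw [smul_eq_mul, ← mul_assoc, abs_mul, abs_of_nonneg hq, mul_comm]
      exact mul_le_mul_of_nonneg_right (hδ i) hq
    refine h1.trans ?_
    have h2 := mul_le_mul_of_nonneg_left hb.1 hδ0
    rw [card_univ] at h2
    linear_combination (1 / 0.981) * h2

/-! ### Contraction across at most four clauses -/

/-- The inequality behind the value `0.981`: it is the squared derivative bound when all four
`tanh²` equal `A`, and little slack remains. -/
theorem quintic_bound {A : ℝ} (h1 : A ≤ 1) :
    16 * A * (1 - A) ^ 4 ≤ 0.981 ^ 2 * (1 + (1 - A) ^ 4) := by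
  set b := 1 - A with hb
  have hb0 : 0 ≤ b := by linarith
  have hA : A = 1 - b := by linarith
  rw [hA]
  -- `c = (16 - 0.981²) / 20` is the positive critical point of `4b⁵ - 5cb⁴`, whose minimum `-c⁵`
  -- over `b ≥ 0` is exhibited by the factor `(b - c)²`.
  set c : ℝ := 0.75188195 with hc
  have h : 0 ≤ (b - c) ^ 2 * (4 * b ^ 3 + 3 * c * b ^ 2 + 2 * c ^ 2 * b + c ^ 3) := by
    rw [hc]; positivity
  have h4 : (b - c) ^ 2 * (4 * b ^ 3 + 3 * c * b ^ 2 + 2 * c ^ 2 * b + c ^ 3)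
      = 4 * b ^ 5 - 5 * c * b ^ 4 + c ^ 5 := by ring
  rw [h4] at h
  have h5 : 4 * c ^ 5 ≤ 0.962 := by rw [hc]; norm_num
  have h6 : 20 * c = 16 - 0.981 ^ 2 := by rw [hc]; norm_num
  have h7 : 20 * c * b ^ 4 = (16 - 0.981 ^ 2) * b ^ 4 := by rw [h6]
  have h8 : (0.962 : ℝ) ≤ 0.981 ^ 2 := by norm_num
  linear_combination 4 * h + h5 + h7 + h8

theorem prod_one_sub_le {κ : Type*} [Fintype κ] (hκ : Fintype.card κ ≤ 4) (a : κ → ℝ)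
    (h1 : ∀ j, a j ≤ 1) : ∏ j, (1 - a j) ≤ (1 - (∑ j, a j) / 4) ^ 4 := by
  obtain ⟨n, hn⟩ := Nat.exists_eq_add_of_le hκ
  -- Padding with ones to exactly four factors lets AM-GM give the exponent `4` for every smaller
  -- index set.
  set b : κ ⊕ Fin n → ℝ := Sum.elim (fun j => 1 - a j) (fun _ => 1) with hb
  have hcard : Fintype.card (κ ⊕ Fin n) = 4 := by simp [← hn]
  have hb0 : ∀ i, 0 ≤ b i := by
    rintro (j | i)
    · simpa [hb] using h1 j
    · simp [hb]
  have hsum : ∑ i, b i = 4 - ∑ j, a j := by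
    have : ((Fintype.card κ : ℝ) + n) = 4 := by exact_mod_cast hn.symm
    simp only [hb, Fintype.sum_sum_type, Sum.elim_inl, Sum.elim_inr, sum_sub_distrib, sum_const,
      card_univ, Fintype.card_fin, nsmul_eq_mul, mul_one]
    linarith
  have h := geom_mean_le_arith_mean univ (fun _ => (1 : ℝ)) b (fun _ _ => zero_le_one)
    (by simp [-Fintype.card_sum, hcard]) (fun i _ => hb0 i)
  simp only [rpow_one, sum_const, card_univ, hcard, nsmul_eq_mul, mul_one, one_mul, hsum] at h
  have hP0 : 0 ≤ ∏ i, b i := prod_nonneg fun i _ => hb0 i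
  have h2 := pow_le_pow_left₀ (rpow_nonneg hP0 _) h 4
  rw [← rpow_natCast, ← rpow_mul hP0] at h2
  have h3 : ∏ i, b i = ∏ j, (1 - a j) := by simp [hb, Fintype.prod_sum_type]
  rw [h3] at h2
  norm_num at h2
  calc _ ≤ _ := h2
    _ = _ := by ring

/-- With `A` a quarter of the sum of the `tanh²`, Cauchy-Schwarz bounds the sum of the `|tanh|` and
AM-GM bounds `g² = ∏ (1 - tanh²)`; this reduces the claim to `quintic_bound`. -/
theorem arsinh_prod_derivative_bound {κ : Type*} [Fintype κ] (hκ : Fintype.card κ ≤ 4) (τ : κ → ℝ) :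
    (√(1 + (∏ j, (cosh (τ j))⁻¹) ^ 2))⁻¹ * ((∏ j, (cosh (τ j))⁻¹) * ∑ j, |tanh (τ j)|)
      ≤ 0.981 := by
  set g := ∏ j, (cosh (τ j))⁻¹ with hg
  set T := ∑ j, |tanh (τ j)| with hT
  have hg0 : 0 < g := prod_pos fun j _ => inv_pos.mpr (cosh_pos _)
  have hT0 : 0 ≤ T := sum_nonneg fun j _ => abs_nonneg _
  set A := (∑ j, tanh (τ j) ^ 2) / 4 with hA
  have hA1 : A ≤ 1 := by
    have h : ∑ j, tanh (τ j) ^ 2 ≤ ∑ _j : κ, (1 : ℝ) :=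
      sum_le_sum fun j _ => (tanh_sq_lt_one _).le
    have h' : (Fintype.card κ : ℝ) ≤ 4 := by exact_mod_cast hκ
    simp only [sum_const, card_univ, nsmul_eq_mul, mul_one] at h
    rw [hA]; linarith
  have hA0 : 0 ≤ A := by rw [hA]; positivity
  have hT2 : T ^ 2 ≤ 16 * A := by
    have h := sq_sum_le_card_mul_sum_sq (s := (univ : Finset κ)) (f := fun j => |tanh (τ j)|)
    simp only [sq_abs, card_univ] at h
    have h' : (Fintype.card κ : ℝ) ≤ 4 := by exact_mod_cast hκ
    have h'' := mul_le_mul_of_nonneg_right h' (by positivity : 0 ≤ ∑ j, tanh (τ j) ^ 2)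
    rw [hA]; linarith
  have hg2 : g ^ 2 ≤ (1 - A) ^ 4 := by
    have h := prod_one_sub_le hκ (fun j => tanh (τ j) ^ 2) (fun j => (tanh_sq_lt_one _).le)
    refine le_of_eq_of_le ?_ h
    rw [hg, ← prod_pow]
    refine prod_congr rfl fun j _ => ?_
    have := (cosh_pos (τ j)).ne'
    rw [tanh_eq_sinh_div_cosh]
    field_simp
    linarith [cosh_sq (τ j)]
  have hq := quintic_bound hA1
  have hs : 0 < √(1 + g ^ 2) := by positivity
  rw [inv_mul_le_iff₀ hs]
  refine le_of_sq_le_sq ?_ (by positivity)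
  rw [mul_pow, mul_pow, sq_sqrt (by positivity)]
  -- The goal is `g² (T² - 0.981²) ≤ 0.981²`. The bound on `g²` may be inserted only if the bracket
  -- is nonnegative; otherwise the claim is trivial.
  rcases le_total (T ^ 2) (0.981 ^ 2) with h | h
  · have := mul_le_mul_of_nonneg_left h (sq_nonneg g)
    linear_combination this + (0.981 : ℝ) ^ 2 * (zero_le_one' ℝ)
  · have h1 := mul_le_mul hg2 (sub_le_sub_right hT2 (0.981 ^ 2)) (by linarith) (by positivity)
    linear_combination h1 + hq

theorem arsinh_prod_lipschitz {κ : Type*} [Fintype κ] (hκ : Fintype.card κ ≤ 4) (τ τ' : κ → ℝ)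
    {δ : ℝ} (hδ0 : 0 ≤ δ) (hδ : ∀ j, |τ' j - τ j| ≤ δ) :
    |arsinh (∏ j, (cosh (τ' j))⁻¹) - arsinh (∏ j, (cosh (τ j))⁻¹)| ≤ 0.981 * δ := by
  classical
  set p : ℝ → κ → ℝ := fun θ j => τ j + θ * (τ' j - τ j) with hp
  have hder : ∀ θ, HasDerivAt (fun θ => arsinh (∏ j, (cosh (p θ j))⁻¹))
      ((√(1 + (∏ j, (cosh (p θ j))⁻¹) ^ 2))⁻¹ *
        ∑ j, (∏ k ∈ univ.erase j, (cosh (p θ k))⁻¹) •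
          (-(sinh (p θ j) * (τ' j - τ j)) / cosh (p θ j) ^ 2)) θ := by
    intro θ
    have h1 : ∀ j ∈ univ, HasDerivAt (fun θ => (cosh (p θ j))⁻¹)
        (-(sinh (p θ j) * (τ' j - τ j)) / cosh (p θ j) ^ 2) θ := by
      intro j _
      refine HasDerivAt.fun_inv (HasDerivAt.cosh ?_) (cosh_pos _).ne'
      simpa [hp] using ((hasDerivAt_id θ).mul_const (τ' j - τ j)).const_add (τ j)
    simpa using (HasDerivAt.fun_finsetProd h1).arsinh
  have key := abs_sub_le_of_path (K := 0.981 * δ) (fun θ _ => hder θ) ?_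
  · simpa only [hp, one_mul, zero_mul, add_zero, add_sub_cancel] using key
  · intro θ _
    have hb := arsinh_prod_derivative_bound hκ (p θ)
    have hg0 : 0 ≤ ∏ j, (cosh (p θ j))⁻¹ := prod_nonneg fun j _ => (inv_pos.mpr (cosh_pos _)).le
    have h1 : ∑ j, (∏ k ∈ univ.erase j, (cosh (p θ k))⁻¹) •
          (-(sinh (p θ j) * (τ' j - τ j)) / cosh (p θ j) ^ 2)
        = -((∏ j, (cosh (p θ j))⁻¹) * ∑ j, tanh (p θ j) * (τ' j - τ j)) := by
      rw [mul_sum, ← sum_neg_distrib]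
      refine sum_congr rfl fun j _ => ?_
      rw [← prod_erase_mul _ _ (mem_univ j), tanh_eq_sinh_div_cosh, smul_eq_mul]
      have := (cosh_pos (p θ j)).ne'
      field_simp
    have h2 : |∑ j, tanh (p θ j) * (τ' j - τ j)| ≤ (∑ j, |tanh (p θ j)|) * δ := by
      rw [sum_mul]
      refine (abs_sum_le_sum_abs _ _).trans (sum_le_sum fun j _ => ?_)
      rw [abs_mul]
      exact mul_le_mul_of_nonneg_left (hδ j) (abs_nonneg _)
    rw [h1, abs_mul, abs_neg, abs_mul, abs_of_nonneg hg0, abs_of_nonneg (by positivity)]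
    calc _ ≤ (√(1 + (∏ j, (cosh (p θ j))⁻¹) ^ 2))⁻¹ *
          ((∏ j, (cosh (p θ j))⁻¹) * ((∑ j, |tanh (p θ j)|) * δ)) := by gcongr
      _ = (√(1 + (∏ j, (cosh (p θ j))⁻¹) ^ 2))⁻¹ *
          ((∏ j, (cosh (p θ j))⁻¹) * ∑ j, |tanh (p θ j)|) * δ := by ring
      _ ≤ _ := mul_le_mul_of_nonneg_right hb hδ0

/-- The clause coordinate `artanh √P` of the probability `P` that a clause fails. -/
noncomputable def clauseCoord (P : ℝ) : ℝ := artanh √P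

/-- The ratio coordinate `arsinh √R`. -/
noncomputable def ratioCoord (R : ℝ) : ℝ := arsinh √R

/-! ### Transfer to ratios and probabilities -/

theorem tanh_clauseCoord {P : ℝ} (h1 : P < 1) : tanh (clauseCoord P) = √P :=
  tanh_artanh ⟨by have := sqrt_nonneg P; linarith, by
    rw [sqrt_lt' one_pos]; simpa using h1⟩

theorem tanh_ratioCoord {R : ℝ} (h0 : 0 ≤ R) : tanh (ratioCoord R) = √(R / (1 + R)) := by
  rw [ratioCoord, tanh_arsinh, sq_sqrt h0, sqrt_div h0]

theorem ratioCoord_mem {R : ℝ} (h1 : R ≤ 1) :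
    ratioCoord R ∈ Set.Icc 0 (arsinh 1) := by
  refine ⟨arsinh_nonneg_iff.mpr (sqrt_nonneg R), arsinh_le_arsinh.mpr ?_⟩
  rw [sqrt_le_one]; exact h1

/-- Base case of the decay, at depth `0`: the coordinates fill an interval of length `arsinh 1 ≤ 1`.
-/
theorem abs_ratioCoord_sub_le_one {R R' : ℝ} (hR : R ∈ Set.Icc (0 : ℝ) 1)
    (hR' : R' ∈ Set.Icc (0 : ℝ) 1) : |ratioCoord R - ratioCoord R'| ≤ 1 := by
  have h1 := ratioCoord_mem hR.2
  have h2 := ratioCoord_mem hR'.2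
  have h3 : arsinh 1 ≤ 1 := by
    rw [← sinh_le_sinh, sinh_arsinh]
    exact self_le_sinh_iff.mpr zero_le_one
  rw [abs_le]
  constructor <;> linarith [h1.1, h1.2, h2.1, h2.2]

theorem clauseCoord_prod {ι : Type*} [Fintype ι] {R : ι → ℝ} (h0 : ∀ i, 0 ≤ R i) :
    clauseCoord (∏ i, R i / (1 + R i)) = artanh (∏ i, tanh (ratioCoord (R i))) := by
  rw [clauseCoord, sqrt_prod _ (fun i _ => div_nonneg (h0 i) (by linarith [h0 i]))]
  congr 1
  exact prod_congr rfl fun i _ => (tanh_ratioCoord (h0 i)).symm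

theorem clauseCoord_lipschitz {ι : Type*} [Fintype ι] [Nonempty ι] {R R' : ι → ℝ}
    (hR : ∀ i, R i ∈ Set.Icc (0 : ℝ) 1) (hR' : ∀ i, R' i ∈ Set.Icc (0 : ℝ) 1) {δ : ℝ}
    (hδ : ∀ i, |ratioCoord (R' i) - ratioCoord (R i)| ≤ δ) :
    0.981 * |clauseCoord (∏ i, R' i / (1 + R' i)) - clauseCoord (∏ i, R i / (1 + R i))|
      ≤ 0.981 ^ Fintype.card ι * δ := by
  rw [clauseCoord_prod fun i => (hR i).1, clauseCoord_prod fun i => (hR' i).1]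
  exact artanh_prod_tanh_lipschitz _ _ (fun i => ratioCoord_mem (hR i).2)
    (fun i => ratioCoord_mem (hR' i).2) hδ

theorem ratioCoord_prod {κ : Type*} [Fintype κ] {P : κ → ℝ} (hP : ∀ j, P j ∈ Set.Ico (0 : ℝ) 1) :
    ratioCoord (∏ j, (1 - P j)) = arsinh (∏ j, (cosh (clauseCoord (P j)))⁻¹) := by
  rw [ratioCoord, sqrt_prod _ (fun j _ => by linarith [(hP j).2])]
  congr 1
  refine prod_congr rfl fun j _ => ?_
  have h : √(P j) ∈ Set.Ioo (-1 : ℝ) 1 := ⟨by have := sqrt_nonneg (P j); linarith, by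
    rw [sqrt_lt' one_pos]; simpa using (hP j).2⟩
  rw [clauseCoord, cosh_artanh h, sq_sqrt (hP j).1, one_div, inv_inv]

theorem ratioCoord_prod_lipschitz {κ : Type*} [Fintype κ] (hκ : Fintype.card κ ≤ 4) {P P' : κ → ℝ}
    (hP : ∀ j, P j ∈ Set.Ico (0 : ℝ) 1) (hP' : ∀ j, P' j ∈ Set.Ico (0 : ℝ) 1) {δ : ℝ}
    (hδ0 : 0 ≤ δ) (hδ : ∀ j, |clauseCoord (P' j) - clauseCoord (P j)| ≤ δ) :
    |ratioCoord (∏ j, (1 - P' j)) - ratioCoord (∏ j, (1 - P j))| ≤ 0.981 * δ := by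
  rw [ratioCoord_prod hP, ratioCoord_prod hP']
  exact arsinh_prod_lipschitz hκ _ _ hδ0 hδ

theorem abs_tanh_sub_tanh_le (x y : ℝ) : |tanh x - tanh y| ≤ |x - y| := by
  have h := (convex_univ (𝕜 := ℝ) (E := ℝ)).norm_image_sub_le_of_norm_hasDerivWithin_le (C := 1)
    (fun x _ => (hasDerivAt_tanh x).hasDerivWithinAt)
    (fun x _ => by
      have h1 := tanh_sq_lt_one x
      rw [norm_eq_abs, abs_le]
      constructor <;> nlinarith [sq_nonneg (tanh x)]) (Set.mem_univ y) (Set.mem_univ x)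
  simpa using h

theorem abs_prod_sub_prod_le {κ : Type*} (s : Finset κ) {a b : κ → ℝ}
    (ha : ∀ j ∈ s, a j ∈ Set.Icc (0 : ℝ) 1) (hb : ∀ j ∈ s, b j ∈ Set.Icc (0 : ℝ) 1) :
    |∏ j ∈ s, a j - ∏ j ∈ s, b j| ≤ ∑ j ∈ s, |a j - b j| := by
  classical
  induction s using Finset.induction_on with
  | empty => simp
  | insert i s hi ih =>
    have ih' := ih (fun j hj => ha j (mem_insert_of_mem hj)) (fun j hj => hb j (mem_insert_of_mem hj))
    have hai := ha i (mem_insert_self i s)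
    have hB0 : 0 ≤ ∏ j ∈ s, b j := prod_nonneg fun j hj => (hb j (mem_insert_of_mem hj)).1
    have hB1 : ∏ j ∈ s, b j ≤ 1 := prod_le_one (fun j hj => (hb j (mem_insert_of_mem hj)).1)
      (fun j hj => (hb j (mem_insert_of_mem hj)).2)
    rw [prod_insert hi, prod_insert hi, sum_insert hi]
    have e : a i * ∏ j ∈ s, a j - b i * ∏ j ∈ s, b j
        = (a i - b i) * ∏ j ∈ s, b j + a i * (∏ j ∈ s, a j - ∏ j ∈ s, b j) := by ring
    rw [e]
    refine (abs_add_le _ _).trans (add_le_add ?_ ?_)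
    · rw [abs_mul, abs_of_nonneg hB0]
      exact mul_le_of_le_one_right (abs_nonneg _) hB1
    · rw [abs_mul, abs_of_nonneg hai.1]
      exact (mul_le_of_le_one_left (abs_nonneg _) hai.2).trans ih'

/-- The last layer at the root, for any number of clauses: each factor `1 - tanh² v` is 2-Lipschitz
in `v`, and all factors lie in `[0, 1]`. -/
theorem abs_prod_one_sub_sub_le {κ : Type*} [Fintype κ] {P P' : κ → ℝ}
    (hP : ∀ j, P j ∈ Set.Ico (0 : ℝ) 1) (hP' : ∀ j, P' j ∈ Set.Ico (0 : ℝ) 1) {δ : ℝ}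
    (hδ : ∀ j, |clauseCoord (P' j) - clauseCoord (P j)| ≤ δ) :
    |∏ j, (1 - P' j) - ∏ j, (1 - P j)| ≤ 2 * Fintype.card κ * δ := by
  have hmem : ∀ {x : ℝ}, x ∈ Set.Ico (0 : ℝ) 1 → 1 - x ∈ Set.Icc (0 : ℝ) 1 :=
    fun h => ⟨by linarith [h.2], by linarith [h.1]⟩
  refine (abs_prod_sub_prod_le univ (fun j _ => hmem (hP' j)) (fun j _ => hmem (hP j))).trans ?_
  have : ∑ j : κ, |1 - P' j - (1 - P j)| ≤ ∑ _j : κ, 2 * δ := by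
    refine sum_le_sum fun j _ => ?_
    have h1 : ∀ {x : ℝ}, x ∈ Set.Ico (0 : ℝ) 1 → x = tanh (clauseCoord x) ^ 2 :=
      fun h => by rw [tanh_clauseCoord h.2, sq_sqrt h.1]
    rw [h1 (hP j), h1 (hP' j)]
    set x := clauseCoord (P j)
    set y := clauseCoord (P' j)
    have e : 1 - tanh y ^ 2 - (1 - tanh x ^ 2) = -((tanh y + tanh x) * (tanh y - tanh x)) := by ring
    rw [e, abs_neg, abs_mul]
    refine mul_le_mul ?_ ((abs_tanh_sub_tanh_le y x).trans (hδ j)) (abs_nonneg _) zero_le_two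
    have := abs_add_le (tanh y) (tanh x)
    linarith [abs_tanh_lt_one x, abs_tanh_lt_one y]
  refine this.trans (le_of_eq ?_)
  rw [sum_const, card_univ, nsmul_eq_mul]
  ring

end Analysis

end MonCNF

namespace MonCNF

/-! ### Exact recursion -/

section Counting

variable {V : Type*} [DecidableEq V]

theorem Clause.mem_pin {c : Clause V} {x y : V} : y ∈ Clause.pin c x ↔ y ∈ c ∧ y ≠ x :=
  Multiset.mem_filter

theorem Clause.mem_of_pin_eq_zero {c : Clause V} {x : V} (hc : c ≠ 0) (h : Clause.pin c x = 0) :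
    x ∈ c := by
  obtain ⟨y, hy⟩ := Multiset.exists_mem_of_ne_zero hc
  by_contra hx
  have : y ∈ Clause.pin c x := Clause.mem_pin.mpr ⟨hy, fun e => hx (e ▸ hy)⟩
  simp [h] at this

theorem Clause.card_pin {c : Clause V} {x : V} (hx : x ∈ c) :
    (Clause.pin c x).toFinset.card = Clause.size c - 1 := by
  rw [Clause.pin, Multiset.toFinset_filter, Finset.filter_ne', Clause.size,
    Finset.card_erase_of_mem (Multiset.mem_toFinset.mpr hx)]

theorem notMem_of_mem_pin {C : Formula V} {x : V} {c : Clause V} (hc : c ∈ C.pin x) : x ∉ c := by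
  obtain ⟨c, _, rfl⟩ := Multiset.mem_map.mp hc
  simp [Clause.mem_pin]

theorem two_mul_card_filter {A : Finset (V → Bool)} {x : V}
    (hA : ∀ σ ∈ A, ∀ b, Function.update σ x b ∈ A) (b : Bool) :
    2 * (A.filter (fun σ => σ x = b)).card = A.card := by
  have h1 : ∀ b, (A.filter (fun σ => σ x = b)).card ≤ (A.filter (fun σ => σ x = !b)).card := by
    intro b
    refine Finset.card_le_card_of_injOn (fun σ => Function.update σ x (!b)) ?_ ?_
    · intro σ hσ
      simp only [Finset.coe_filter, Set.mem_ofPred_eq] at hσ ⊢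
      exact ⟨hA σ hσ.1 _, by simp⟩
    · intro σ hσ τ hτ h
      simp only [Finset.coe_filter, Set.mem_ofPred_eq] at hσ hτ
      funext y
      by_cases hy : y = x
      · rw [hy, hσ.2, hτ.2]
      · simpa [hy] using congrFun h y
  have h2 := h1 b
  have h3 := h1 (!b)
  rw [Bool.not_not] at h3
  have h4 := Finset.card_filter_add_card_filter_not (s := A) (fun σ => σ x = b)
  have h5 : A.filter (fun σ => ¬ σ x = b) = A.filter (fun σ => σ x = !b) :=
    Finset.filter_congr fun σ _ => by simp [Bool.eq_not]
  rw [h5] at h4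
  omega

variable [Fintype V]

theorem mem_sat {C : Formula V} {σ : V → Bool} : σ ∈ sat C ↔ ∀ c ∈ C, ∃ y ∈ c, σ y = true := by
  simp [sat]

theorem sat_nonempty {C : Formula V} (hC : 0 ∉ C) : (sat C).Nonempty := by
  refine ⟨fun _ => true, mem_sat.mpr fun c hc => ?_⟩
  obtain ⟨y, hy⟩ := Multiset.exists_mem_of_ne_zero (fun h => hC (h ▸ hc) : c ≠ 0)
  exact ⟨y, hy, rfl⟩

theorem zero_notMem_of_sat_nonempty {C : Formula V} (h : (sat C).Nonempty) : 0 ∉ C := by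
  intro h0
  obtain ⟨σ, hσ⟩ := h
  obtain ⟨y, hy, _⟩ := mem_sat.mp hσ 0 h0
  simp at hy

theorem mem_sat_pin_of_false {C : Formula V} {x : V} {σ : V → Bool} (hσ : σ x = false) :
    σ ∈ sat (C.pin x) ↔ σ ∈ sat C := by
  simp only [mem_sat, Formula.pin, Multiset.forall_mem_map_iff, Clause.mem_pin]
  refine forall₂_congr fun c _ => exists_congr fun y => ?_
  constructor
  · rintro ⟨⟨h1, -⟩, h2⟩
    exact ⟨h1, h2⟩
  · rintro ⟨h1, h2⟩
    refine ⟨⟨h1, ?_⟩, h2⟩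
    rintro rfl
    simp [hσ] at h2

theorem update_mem_sat {C : Formula V} {x : V} (hx : ∀ c ∈ C, x ∉ c) {σ : V → Bool} (b : Bool)
    (hσ : σ ∈ sat C) : Function.update σ x b ∈ sat C := by
  rw [mem_sat] at hσ ⊢
  intro c hc
  obtain ⟨y, hy, h⟩ := hσ c hc
  refine ⟨y, hy, ?_⟩
  rwa [Function.update_of_ne]
  rintro rfl
  exact hx c hc hy

/-- The number of satisfying assignments vanishing on `l`. -/
def zeroCount (C : Formula V) (l : List V) : ℕ :=
  ((sat C).filter (fun σ => ∀ y ∈ l, σ y = false)).card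

/-- On `x = 0` pinning changes nothing, and in the pinned formula `x` is free, so exactly half of
its assignments have `x = 0`. -/
theorem zeroCount_cons (C : Formula V) {x : V} {l : List V} (hx : x ∉ l) :
    2 * zeroCount C (x :: l) = zeroCount (C.pin x) l := by
  have h := two_mul_card_filter
    (A := (sat (C.pin x)).filter (fun σ => ∀ y ∈ l, σ y = false)) (x := x) (fun σ hσ b => by
      rw [Finset.mem_filter] at hσ ⊢
      refine ⟨update_mem_sat (fun c => notMem_of_mem_pin) b hσ.1, fun y hy => ?_⟩
      have hyx : y ≠ x := fun e => hx (e ▸ hy)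
      rw [Function.update_of_ne hyx]
      exact hσ.2 y hy) false
  have e : (sat C).filter (fun σ => ∀ y ∈ x :: l, σ y = false)
      = ((sat (C.pin x)).filter (fun σ => ∀ y ∈ l, σ y = false)).filter (fun σ => σ x = false) := by
    ext σ
    simp only [Finset.mem_filter, List.forall_mem_cons]
    constructor
    · rintro ⟨h1, h2, h3⟩
      exact ⟨⟨(mem_sat_pin_of_false h2).mpr h1, h3⟩, h2⟩
    · rintro ⟨⟨h1, h3⟩, h2⟩
      exact ⟨(mem_sat_pin_of_false h2).mp h1, h2, h3⟩
  rwa [← e] at h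

theorem zeroCount_nil (C : Formula V) : zeroCount C [] = (sat C).card := by
  simp [zeroCount]

theorem marginal_false_eq (C : Formula V) (x : V) :
    marginal C x false = (sat (C.pin x)).card / 2 / (sat C).card := by
  have h := zeroCount_cons C (List.not_mem_nil (a := x))
  rw [zeroCount_nil] at h
  have h' : marginal C x false = (zeroCount C [x] : ℝ) / (sat C).card := by
    simp [marginal, zeroCount]
  rw [h', ← h]
  push_cast
  ring

/-- The chain rule for probabilities: conditioning on earlier variables being `0` amounts to pinning
them. -/
theorem zeroCount_div (l : List V) (hl : l.Nodup) : ∀ C : Formula V, (sat C).card ≠ 0 →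
    (zeroCount C l : ℝ) / (sat C).card
      = ∏ i : Fin l.length, marginal ((l.take i).foldl Formula.pin C) (l.get i) false := by
  induction l with
  | nil => intro C hC; simp [zeroCount_nil, hC]
  | cons x l ih =>
    intro C hC
    have hC' : ((sat C).card : ℝ) ≠ 0 := by exact_mod_cast hC
    rw [List.nodup_cons] at hl
    have h1 : (zeroCount C (x :: l) : ℝ) = zeroCount (C.pin x) l / 2 := by
      rw [← zeroCount_cons C hl.1]; push_cast; ring
    rw [h1]
    have h2 := Fin.prod_univ_succ (fun i : Fin (l.length + 1) =>
      marginal (((x :: l).take i).foldl Formula.pin C) ((x :: l).get i) false)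
    refine Eq.trans ?_ h2.symm
    simp only [Fin.val_zero, List.take_zero, List.foldl_nil, List.get_cons_zero, Fin.val_succ,
      List.take_succ_cons, List.foldl_cons, List.get_cons_succ']
    rw [marginal_false_eq]
    -- Pinning may make the formula unsatisfiable; then the factor of `x` is already `0` and the
    -- meaningless later factors do not matter.
    by_cases hp : (sat (C.pin x)).card = 0
    · have h3 : zeroCount (C.pin x) l = 0 := by
        rw [zeroCount, Finset.card_eq_zero.mp hp]; simp
      simp [h3, hp]
    · rw [← ih hl.2 _ hp]
      have hp' : ((sat (C.pin x)).card : ℝ) ≠ 0 := by exact_mod_cast hp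
      field_simp

theorem ratio_nonneg (C : Formula V) (x : V) : 0 ≤ ratio C x := by
  unfold ratio marginal; positivity

/-- Raising `x` to `1` keeps a monotone formula satisfied. -/
theorem marginal_false_le (C : Formula V) (x : V) : marginal C x false ≤ marginal C x true := by
  unfold marginal
  gcongr ?_ / _
  norm_cast
  refine Finset.card_le_card_of_injOn (fun σ => Function.update σ x true) ?_ ?_
  · intro σ hσ
    simp only [Finset.coe_filter, Set.mem_ofPred_eq, mem_sat] at hσ ⊢
    refine ⟨fun c hc => ?_, by simp⟩
    obtain ⟨y, hy, h⟩ := hσ.1 c hc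
    refine ⟨y, hy, ?_⟩
    by_cases hyx : y = x
    · simp [hyx]
    · simpa [hyx] using h
  · intro σ hσ τ hτ h
    simp only [Finset.coe_filter, Set.mem_ofPred_eq] at hσ hτ
    funext y
    by_cases hy : y = x
    · rw [hy, hσ.2, hτ.2]
    · simpa [hy] using congrFun h y

theorem ratio_le_one (C : Formula V) (x : V) : ratio C x ≤ 1 :=
  div_le_one_of_le₀ (marginal_false_le C x) (by unfold marginal; positivity)

theorem card_sat_split (C : Formula V) (x : V) :
    ((sat C).filter (fun σ => σ x = false)).card + ((sat C).filter (fun σ => σ x = true)).card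
      = (sat C).card := by
  have h := Finset.card_filter_add_card_filter_not (s := sat C) (fun σ => σ x = false)
  simpa only [Bool.not_eq_false] using h

theorem ratio_div_one_add (C : Formula V) (x : V) :
    ratio C x / (1 + ratio C x) = marginal C x false := by
  by_cases h : (sat C).card = 0
  · simp [ratio, marginal, h]
  · have h0 := zero_notMem_of_sat_nonempty (Finset.card_ne_zero.mp h)
    have h1 := marginal_true_pos C (fun c hc e => h0 (e ▸ hc)) x
    have h2 : marginal C x false + marginal C x true = 1 := by
      have h3 : ((sat C).card : ℝ) ≠ 0 := by exact_mod_cast h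
      have h4 := card_sat_split C x
      unfold marginal
      rw [← add_div, div_eq_one_iff_eq h3]
      exact_mod_cast h4
    unfold ratio
    field_simp
    rw [add_comm, h2]
    simp

theorem ratio_eq_zero {C : Formula V} {x : V} {c : Clause V} (hc : c ∈ C)
    (h : Clause.pin c x = 0) : ratio C x = 0 := by
  have : (sat C).filter (fun σ => σ x = false) = ∅ := by
    refine Finset.filter_eq_empty_iff.mpr fun σ hσ hx => ?_
    obtain ⟨y, hy, hy'⟩ := mem_sat.mp hσ c hc
    have : y ∈ Clause.pin c x := Clause.mem_pin.mpr ⟨hy, fun e => by simp [← e, hy'] at hx⟩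
    simp [h] at this
  simp [ratio, marginal, this]

theorem card_sat_add_singleton (C : Formula V) (c : Clause V) {l : List V}
    (hl : ∀ y, y ∈ l ↔ y ∈ c) : (sat (C + {c})).card + zeroCount C l = (sat C).card := by
  classical
  rw [← Finset.card_filter_add_card_filter_not (s := sat C)
    (fun σ : V → Bool => ∃ y ∈ c, σ y = true), zeroCount]
  congr 2
  · ext σ
    simp only [Finset.mem_filter, mem_sat, Multiset.mem_add, Multiset.mem_singleton]
    constructor
    · exact fun h => ⟨fun c hc => h c (Or.inl hc), h c (Or.inr rfl)⟩
    · rintro ⟨h1, h2⟩ d (hd | rfl)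
      exacts [h1 d hd, h2]
  · refine Finset.filter_congr fun σ _ => ?_
    simp [hl]

/-- Setting `x = 0` pins it, setting `x = 1` deletes its clauses; `x` is free in both resulting
formulas, so the factors `1/2` cancel. -/
theorem ratio_eq_card_div {C : Formula V} (hC : 0 ∉ C) (x : V) :
    ratio C x = ((sat (C.pin x)).card : ℝ) / (sat (C.filter (fun c => x ∉ c))).card := by
  have h0 : ((sat C).card : ℝ) ≠ 0 := by
    exact_mod_cast Finset.card_ne_zero.mpr (sat_nonempty hC)
  have e : (sat C).filter (fun σ => σ x = true)
      = (sat (C.filter (fun c => x ∉ c))).filter (fun σ => σ x = true) := by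
    ext σ
    simp only [Finset.mem_filter, mem_sat, Multiset.mem_filter]
    refine and_congr_left fun hx => ⟨fun h c hc => h c hc.1, fun h c hc => ?_⟩
    by_cases hxc : x ∈ c
    · exact ⟨x, hxc, hx⟩
    · exact h c ⟨hc, hxc⟩
  have h1 := two_mul_card_filter (A := sat (C.filter (fun c => x ∉ c))) (x := x)
    (fun σ hσ b => update_mem_sat (fun c hc => (Multiset.mem_filter.mp hc).2) b hσ) true
  rw [ratio, marginal_false_eq, marginal, e, ← h1, div_div_div_cancel_right₀ h0]
  push_cast
  rw [div_div]

/-- Telescoping over the clauses that contain a variable. -/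
theorem card_sat_add_div (D : Formula V) (cs : List (Clause V)) (h : 0 ∉ D)
    (hcs : ∀ c ∈ cs, c ≠ 0) :
    ((sat (D + (cs : Formula V))).card : ℝ) / (sat D).card
      = ∏ j : Fin cs.length, ((sat (D + (cs.drop (j + 1) : Formula V) + {cs.get j})).card : ℝ) /
          (sat (D + (cs.drop (j + 1) : Formula V))).card := by
  have hpos : ∀ cs : List (Clause V), (∀ c ∈ cs, c ≠ 0) →
      ((sat (D + (cs : Formula V))).card : ℝ) ≠ 0 := by
    intro cs hcs
    have : 0 ∉ D + (cs : Formula V) := by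
      simp only [Multiset.mem_add, Multiset.mem_coe, not_or]
      exact ⟨h, fun h' => hcs 0 h' rfl⟩
    exact_mod_cast Finset.card_ne_zero.mpr (sat_nonempty this)
  induction cs with
  | nil => simpa using div_self (hpos [] (by simp))
  | cons c cs ih =>
    have hcs' : ∀ d ∈ cs, d ≠ 0 := fun d hd => hcs d (List.mem_cons_of_mem c hd)
    have h2 := Fin.prod_univ_succ (fun j : Fin (cs.length + 1) =>
      ((sat (D + ((c :: cs).drop (j + 1) : Formula V) + {(c :: cs).get j})).card : ℝ) /
          (sat (D + ((c :: cs).drop (j + 1) : Formula V))).card)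
    refine Eq.trans ?_ h2.symm
    simp only [Fin.val_zero, zero_add, List.drop_succ_cons, List.drop_zero, List.get_cons_zero,
      Fin.val_succ, List.get_cons_succ']
    rw [← ih hcs', div_mul_div_cancel₀ (hpos cs hcs')]
    congr 4
    rw [add_assoc, ← Multiset.cons_coe, ← Multiset.singleton_add, add_comm ({c} : Formula V)]

end Counting

namespace Enumeration

variable {V : Type*} [DecidableEq V] (E : Enumeration V) (C : Formula V) (x : V)

theorem get_mem_filter (j : Fin (E.clauses C x).length) :
    (E.clauses C x).get j ∈ C.filter (fun c => x ∈ c) := by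
  rw [← E.coe_clauses]
  exact List.get_mem _ _

theorem length_vars (j : Fin (E.clauses C x).length) :
    (E.vars C x j).length = E.width C x j := by
  rw [width, ← Clause.card_pin (Multiset.mem_filter.mp (E.get_mem_filter C x j)).2,
    ← List.toFinset_card_of_nodup (E.vars_nodup C x j)]
  congr 1
  ext y
  rw [List.mem_toFinset, Multiset.mem_toFinset, E.mem_vars]

theorem length_clauses : (E.clauses C x).length = C.occ x := by
  rw [Formula.occ, Multiset.countP_eq_card_filter, ← E.coe_clauses, Multiset.coe_card]

theorem exists_width_eq_zero {C : Formula V} {x : V} {c : Clause V} (hc : c ∈ C) (h0 : c ≠ 0)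
    (h : Clause.pin c x = 0) : ∃ j, E.width C x j = 0 := by
  have hx := Clause.mem_of_pin_eq_zero h0 h
  have hm : c ∈ (E.clauses C x : Multiset (Clause V)) := by
    rw [E.coe_clauses]; exact Multiset.mem_filter.mpr ⟨hc, hx⟩
  obtain ⟨j, hj⟩ := List.mem_iff_get.mp (Multiset.mem_coe.mp hm)
  refine ⟨j, ?_⟩
  rw [width, ← Clause.card_pin (hj ▸ hx), hj, h]
  simp

theorem pin_get_eq_zero {j : Fin (E.clauses C x).length} (h : E.width C x j = 0) :
    Clause.pin ((E.clauses C x).get j) x = 0 := by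
  rw [width, ← Clause.card_pin (Multiset.mem_filter.mp (E.get_mem_filter C x j)).2] at h
  simpa using h

theorem sub_sub_get (j : Fin (E.clauses C x).length) :
    E.sub C x j - {(E.clauses C x).get j} = C.filter (fun c => x ∉ c) +
      (((E.clauses C x).map (fun c => Clause.pin c x)).drop (j + 1) : Formula V) := by
  have h1 : ((E.clauses C x : Multiset (Clause V)))
      = {(E.clauses C x).get j} + ((E.clauses C x).eraseIdx j : Multiset (Clause V)) := by
    rw [Multiset.singleton_add, Multiset.cons_coe]
    exact Multiset.coe_eq_coe.mpr (List.getElem_cons_eraseIdx_perm j.2).symm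
  have h2 : C = {(E.clauses C x).get j} + ((E.clauses C x).eraseIdx j : Multiset (Clause V))
      + C.filter (fun c => x ∉ c) := by
    rw [← h1, E.coe_clauses, Multiset.filter_add_not]
  have h3 : C - ((E.clauses C x).eraseIdx j : Multiset (Clause V))
      = {(E.clauses C x).get j} + C.filter (fun c => x ∉ c) := by
    exact tsub_eq_of_eq_add (h2.trans (add_right_comm _ _ _))
  rw [sub, h3, List.map_drop, add_assoc, add_tsub_cancel_left]

theorem zero_notMem_sub_sub_get {C : Formula V} (hC : 0 ∉ C) {x : V}
    (hw : ∀ j, E.width C x j ≠ 0) (j : Fin (E.clauses C x).length) :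
    0 ∉ E.sub C x j - {(E.clauses C x).get j} := by
  rw [sub_sub_get, Multiset.mem_add, not_or]
  refine ⟨fun h => hC (Multiset.mem_filter.mp h).1, fun h => ?_⟩
  obtain ⟨c, hc, hc0⟩ := List.mem_map.mp (List.mem_of_mem_drop (Multiset.mem_coe.mp h))
  have hcC : c ∈ C.filter (fun c => x ∈ c) := by rw [← E.coe_clauses]; exact hc
  have hcC' := (Multiset.mem_filter.mp hcC).1
  obtain ⟨k, hk⟩ := E.exists_width_eq_zero hcC' (fun e => hC (e ▸ hcC')) hc0
  exact hw k hk

/-- Restoring the pinned clauses one at a time turns `ratio_eq_card_div` into a product of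
probabilities that the next clause holds. Each is one minus the probability that all its variables
vanish, to which the chain rule applies. -/
theorem ratio_recursion [Fintype V] {C : Formula V} (hC : 0 ∉ C) {x : V}
    (hw : ∀ j, E.width C x j ≠ 0) :
    ratio C x = ∏ j : Fin (E.clauses C x).length,
      (1 - ∏ i : Fin (E.vars C x j).length,
        (ratio (E.subsub C x j i) ((E.vars C x j).get i) /
          (1 + ratio (E.subsub C x j i) ((E.vars C x j).get i)))) := by
  set cs := (E.clauses C x).map (fun c => Clause.pin c x) with hcs
  set D := C.filter (fun c => x ∉ c) with hD
  have hlen : cs.length = (E.clauses C x).length := List.length_map _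
  have h1 : C.pin x = D + (cs : Formula V) := by
    conv_lhs => rw [← Multiset.filter_add_not (fun c => x ∈ c) C]
    rw [Formula.pin, Multiset.map_add, ← E.coe_clauses, Multiset.map_coe, add_comm]
    congr 1
    conv_rhs => rw [← Multiset.map_id D]
    refine Multiset.map_congr rfl fun c hc => ?_
    refine Multiset.filter_eq_self.mpr fun y hy e => ?_
    exact (Multiset.mem_filter.mp hc).2 (e ▸ hy)
  have hD0 : 0 ∉ D := fun h => hC (Multiset.mem_filter.mp h).1
  have hcs0 : ∀ c ∈ cs, c ≠ 0 := by
    rintro _ hc rfl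
    obtain ⟨c, hc, hc0⟩ := List.mem_map.mp hc
    have hcC : c ∈ C.filter (fun c => x ∈ c) := by rw [← E.coe_clauses]; exact hc
    have hcC' := (Multiset.mem_filter.mp hcC).1
    obtain ⟨k, hk⟩ := E.exists_width_eq_zero hcC' (fun e => hC (e ▸ hcC')) hc0
    exact hw k hk
  rw [ratio_eq_card_div hC, h1, card_sat_add_div D cs hD0 hcs0]
  refine Fintype.prod_equiv (finCongr hlen) _ _ fun j => ?_
  set j' := finCongr hlen j with hj'
  have hval : (j' : ℕ) = j := rfl
  have h2 : D + (cs.drop (j + 1) : Formula V) = E.sub C x j' - {(E.clauses C x).get j'} := by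
    rw [sub_sub_get, hval]
  have h3 : cs.get j = Clause.pin ((E.clauses C x).get j') x := by
    simp [hcs, hj']
  have h4 : (sat (E.sub C x j' - {(E.clauses C x).get j'})).card ≠ 0 :=
    Finset.card_ne_zero.mpr (sat_nonempty (E.zero_notMem_sub_sub_get hC hw j'))
  have h4' : ((sat (E.sub C x j' - {(E.clauses C x).get j'})).card : ℝ) ≠ 0 := by
    exact_mod_cast h4
  have h5 := card_sat_add_singleton (E.sub C x j' - {(E.clauses C x).get j'}) _
    (E.mem_vars C x j')
  have h6 := zeroCount_div _ (E.vars_nodup C x j') _ h4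
  rw [h2, h3]
  simp only [ratio_div_one_add]
  unfold subsub
  rw [← h6, eq_sub_iff_add_eq, ← add_div, div_eq_one_iff_eq h4']
  exact_mod_cast h5

/-! ### Reads of the formulas in the recursion -/

theorem occ_pin_le (C : Formula V) (x y : V) : (C.pin x).occ y ≤ C.occ y := by
  rw [Formula.occ, Formula.pin, Multiset.countP_map, Formula.occ, Multiset.countP_eq_card_filter]
  exact Multiset.card_le_card
    (Multiset.monotone_filter_right C fun c hc => (Clause.mem_pin.mp hc).1)

theorem occ_foldl_pin_le (l : List V) (y : V) :
    ∀ C : Formula V, Formula.occ (l.foldl Formula.pin C) y ≤ C.occ y := by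
  induction l with
  | nil => exact fun C => le_rfl
  | cons x l ih => exact fun C => (ih _).trans (occ_pin_le C x y)

theorem occ_sub_sub_get_add (j : Fin (E.clauses C x).length) (y : V) :
    Formula.occ (E.sub C x j - {(E.clauses C x).get j}) y
      + (if y ∈ (E.clauses C x).get j then 1 else 0) ≤ C.occ y := by
  have h1 : C.occ y = Formula.occ (C.filter (fun c => x ∉ c)) y
      + Formula.occ (E.clauses C x : Formula V) y := by
    conv_lhs => rw [← Multiset.filter_add_not (fun c => x ∈ c) C]
    rw [Formula.occ, Multiset.countP_add, ← E.coe_clauses, add_comm]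
    rfl
  have h2 : Formula.occ (((E.clauses C x).map (fun c => Clause.pin c x)).drop (j + 1) : Formula V) y
      ≤ Formula.occ ((E.clauses C x).drop (j + 1) : Formula V) y := by
    rw [← List.map_drop, ← Multiset.map_coe]
    exact occ_pin_le _ x y
  have h3 : Formula.occ ((E.clauses C x).drop (j + 1) : Formula V) y
      + (if y ∈ (E.clauses C x).get j then 1 else 0)
      ≤ Formula.occ (E.clauses C x : Formula V) y := by
    have h4 : ((E.clauses C x).get j :: (E.clauses C x).drop (j + 1)).Sublist (E.clauses C x) := by
      rw [List.get_eq_getElem, ← List.drop_eq_getElem_cons j.2]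
      exact List.drop_sublist _ _
    have h5 := h4.countP_le (p := fun c => decide (y ∈ c))
    rw [List.countP_cons] at h5
    simpa [Formula.occ, Multiset.coe_countP] using h5
  rw [sub_sub_get, Formula.occ, Multiset.countP_add]
  unfold Formula.occ at *
  omega

theorem occ_subsub_le (j : Fin (E.clauses C x).length) (i : Fin (E.vars C x j).length) (y : V) :
    (E.subsub C x j i).occ y ≤ C.occ y :=
  (occ_foldl_pin_le _ y _).trans (le_of_add_le_left (E.occ_sub_sub_get_add C x j y))

/-- The variable lies in the removed clause `c_j`. This brings five occurrences down to four. -/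
theorem occ_subsub_get_lt (j : Fin (E.clauses C x).length) (i : Fin (E.vars C x j).length) :
    (E.subsub C x j i).occ ((E.vars C x j).get i) < C.occ ((E.vars C x j).get i) := by
  have h := E.occ_sub_sub_get_add C x j ((E.vars C x j).get i)
  rw [if_pos (Clause.mem_pin.mp ((E.mem_vars C x j _).mp (List.get_mem _ _))).1] at h
  exact (Nat.succ_le_succ (occ_foldl_pin_le _ _ _)).trans h

/-- Locates the first pinning that empties a clause: just before it, some clause consists of the
next variable alone. -/
theorem exists_pin_eq_zero (l : List V) {C : Formula V} (hC : 0 ∉ C) (n : ℕ) (hn : n ≤ l.length)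
    (h : 0 ∈ (l.take n).foldl Formula.pin C) :
    ∃ i : Fin l.length, 0 ∉ (l.take i).foldl Formula.pin C ∧
      ∃ c ∈ (l.take i).foldl Formula.pin C, Clause.pin c (l.get i) = 0 := by
  induction n with
  | zero => exact absurd h hC
  | succ n ih =>
    by_cases h0 : 0 ∈ (l.take n).foldl Formula.pin C
    · exact ih (by omega) h0
    · refine ⟨⟨n, hn⟩, h0, ?_⟩
      rw [List.take_succ_eq_append_getElem hn, List.foldl_append] at h
      obtain ⟨c, hc, hc0⟩ := Multiset.mem_map.mp h
      exact ⟨c, hc, hc0⟩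

end Enumeration

end MonCNF

namespace MonCNF

/-! ### Decay of the truncation error -/

namespace Enumeration

variable {V : Type*} [DecidableEq V] (E : Enumeration V)

theorem truncRatio_of_width_eq_zero {C : Formula V} {x : V} (h : ∃ j, E.width C x j = 0) (L : ℕ) :
    E.truncRatio C x L = 0 := by
  rw [truncRatio, dif_pos h]

theorem truncRatio_of_occ_eq_zero {C : Formula V} {x : V} (h : ¬ ∃ j, E.width C x j = 0) {L : ℕ}
    (h' : C.occ x = 0 ∨ L = 0) : E.truncRatio C x L = 1 := by
  rw [truncRatio, dif_neg h, dif_pos h']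

theorem truncRatio_recursion {C : Formula V} {x : V} (h : ¬ ∃ j, E.width C x j = 0) {L : ℕ}
    (h' : ¬ (C.occ x = 0 ∨ L = 0)) :
    E.truncRatio C x L = ∏ j : Fin (E.clauses C x).length,
      (1 - ∏ i : Fin (E.vars C x j).length,
        (E.truncRatio (E.subsub C x j i) ((E.vars C x j).get i)
            (L - Nat.clog 4 (E.width C x j + 1)) /
          (1 + E.truncRatio (E.subsub C x j i) ((E.vars C x j).get i)
            (L - Nat.clog 4 (E.width C x j + 1))))) := by
  rw [truncRatio, dif_neg h, dif_neg h']

theorem clog_width_pos {w : ℕ} (hw : w ≠ 0) : 0 < Nat.clog 4 (w + 1) :=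
  Nat.clog_pos (by norm_num) (by omega)

theorem clog_width_le (w : ℕ) : Nat.clog 4 (w + 1) ≤ w :=
  Nat.clog_le_of_le_pow (Nat.lt_pow_self (by norm_num))

theorem prod_div_one_add_mem {n : ℕ} {R : Fin n → ℝ} (hR : ∀ i, R i ∈ Set.Icc (0 : ℝ) 1) :
    ∏ i, R i / (1 + R i) ∈ Set.Icc (0 : ℝ) 1 := by
  have h0 : ∀ i, 0 ≤ R i / (1 + R i) := fun i => div_nonneg (hR i).1 (by linarith [(hR i).1])
  exact ⟨Finset.prod_nonneg fun i _ => h0 i, Finset.prod_le_one (fun i _ => h0 i) fun i _ =>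
    div_le_one_of_le₀ (by linarith) (by linarith [(hR i).1])⟩

theorem prod_div_one_add_mem_Ico {n : ℕ} (hn : n ≠ 0) {R : Fin n → ℝ}
    (hR : ∀ i, R i ∈ Set.Icc (0 : ℝ) 1) : ∏ i, R i / (1 + R i) ∈ Set.Ico (0 : ℝ) 1 := by
  refine ⟨(prod_div_one_add_mem hR).1, ?_⟩
  obtain ⟨m, rfl⟩ := Nat.exists_eq_succ_of_ne_zero hn
  rw [Fin.prod_univ_succ]
  have h1 := prod_div_one_add_mem (fun i : Fin m => hR i.succ)
  have h2 : R 0 / (1 + R 0) < 1 := by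
    rw [div_lt_one (by linarith [(hR 0).1])]; linarith
  have h3 : 0 ≤ R 0 / (1 + R 0) := div_nonneg (hR 0).1 (by linarith [(hR 0).1])
  exact (mul_le_of_le_one_right h3 h1.2).trans_lt h2

theorem truncRatio_mem (L : ℕ) : ∀ (C : Formula V) (x : V),
    E.truncRatio C x L ∈ Set.Icc (0 : ℝ) 1 := by
  induction L using Nat.strong_induction_on with
  | _ L ih =>
    intro C x
    by_cases h : ∃ j, E.width C x j = 0
    · simp [E.truncRatio_of_width_eq_zero h]
    by_cases h' : C.occ x = 0 ∨ L = 0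
    · simp [E.truncRatio_of_occ_eq_zero h h']
    rw [E.truncRatio_recursion h h']
    have hP := fun j => prod_div_one_add_mem (n := (E.vars C x j).length) (fun i =>
      ih (L - Nat.clog 4 (E.width C x j + 1))
        (by
          have := clog_width_pos (fun h0 => h ⟨j, h0⟩ : E.width C x j ≠ 0)
          omega) (E.subsub C x j i) ((E.vars C x j).get i))
    exact ⟨Finset.prod_nonneg fun j _ => by linarith [(hP j).2],
      Finset.prod_le_one (fun j _ => by linarith [(hP j).2]) fun j _ => by linarith [(hP j).1]⟩

variable [Fintype V]

theorem ratio_mem (C : Formula V) (x : V) : ratio C x ∈ Set.Icc (0 : ℝ) 1 :=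
  ⟨ratio_nonneg C x, ratio_le_one C x⟩

/-- A bound on the error of all recursive calls bounds the error of every clause factor. -/
theorem clauseCoord_error {C : Formula V} (hC : 0 ∉ C) {x : V} (hw : ∀ j, E.width C x j ≠ 0)
    {L : ℕ} (hL : L ≠ 0) (j : Fin (E.clauses C x).length)
    (ih : ∀ i, 0 ∉ E.subsub C x j i → ∀ M < L,
      |ratioCoord (E.truncRatio (E.subsub C x j i) ((E.vars C x j).get i) M)
        - ratioCoord (ratio (E.subsub C x j i) ((E.vars C x j).get i))| ≤ 0.981 ^ M) :
    |clauseCoord (∏ i : Fin (E.vars C x j).length,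
        (E.truncRatio (E.subsub C x j i) ((E.vars C x j).get i)
            (L - Nat.clog 4 (E.width C x j + 1)) /
          (1 + E.truncRatio (E.subsub C x j i) ((E.vars C x j).get i)
            (L - Nat.clog 4 (E.width C x j + 1)))))
      - clauseCoord (∏ i : Fin (E.vars C x j).length,
        (ratio (E.subsub C x j i) ((E.vars C x j).get i) /
          (1 + ratio (E.subsub C x j i) ((E.vars C x j).get i))))| ≤ 0.981 ^ (L - 1) := by
  have hlen := E.length_vars C x j
  have hpos := clog_width_pos (hw j)
  have hle := clog_width_le (E.width C x j)
  -- The induction hypothesis says nothing about formulas with an empty clause. If one occurs, an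
  -- earlier factor is `0` in both the exact and the truncated product, so the two agree.
  by_cases hbad : ∃ i, 0 ∈ E.subsub C x j i
  · obtain ⟨i, hi⟩ := hbad
    obtain ⟨k, hk0, c, hc, hcp⟩ := exists_pin_eq_zero (E.vars C x j)
      (E.zero_notMem_sub_sub_get hC hw j) i i.2.le hi
    have hc0 : c ≠ 0 := fun e => hk0 (e ▸ hc)
    have e1 : E.truncRatio (E.subsub C x j k) ((E.vars C x j).get k)
        (L - Nat.clog 4 (E.width C x j + 1)) = 0 :=
      E.truncRatio_of_width_eq_zero (E.exists_width_eq_zero hc hc0 hcp) _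
    have e2 : ratio (E.subsub C x j k) ((E.vars C x j).get k) = 0 := ratio_eq_zero hc hcp
    rw [Finset.prod_eq_zero (Finset.mem_univ k) (by rw [e1, zero_div]),
      Finset.prod_eq_zero (Finset.mem_univ k) (by rw [e2, zero_div]), sub_self, abs_zero]
    positivity
  · push Not at hbad
    have : Nonempty (Fin (E.vars C x j).length) :=
      ⟨⟨0, by rw [hlen]; exact Nat.pos_of_ne_zero (hw j)⟩⟩
    have h := clauseCoord_lipschitz (ι := Fin (E.vars C x j).length)
      (fun i => ratio_mem (E.subsub C x j i) ((E.vars C x j).get i))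
      (fun i => E.truncRatio_mem (L - Nat.clog 4 (E.width C x j + 1)) (E.subsub C x j i)
        ((E.vars C x j).get i))
      (fun i => ih i (hbad i) _ (by omega))
    rw [Fintype.card_fin, ← pow_add] at h
    -- The depth spent is at most the width, so the exponent is at least `L`, even when the
    -- subtraction truncates at `0`.
    have h2 : (0.981 : ℝ) ^ ((E.vars C x j).length + (L - Nat.clog 4 (E.width C x j + 1)))
        ≤ 0.981 * 0.981 ^ (L - 1) := by
      rw [← pow_succ']
      exact pow_le_pow_of_le_one (by norm_num) (by norm_num) (by omega)
    exact le_of_mul_le_mul_left (h.trans h2) (by norm_num)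

/-- The bound of four on `x` alone is what the recursion reproduces: other variables may still occur
five times, but each loses a clause before it is called. -/
theorem ratioCoord_error (L : ℕ) : ∀ (C : Formula V) (x : V), 0 ∉ C → (∀ y, C.occ y ≤ 5) →
    C.occ x ≤ 4 →
    |ratioCoord (E.truncRatio C x L) - ratioCoord (ratio C x)| ≤ 0.981 ^ L := by
  induction L using Nat.strong_induction_on with
  | _ L ih =>
    intro C x hC hread hx
    by_cases h : ∃ j, E.width C x j = 0
    · obtain ⟨j, hj⟩ := h
      rw [E.truncRatio_of_width_eq_zero ⟨j, hj⟩,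
        ratio_eq_zero (Multiset.mem_filter.mp (E.get_mem_filter C x j)).1
          (E.pin_get_eq_zero C x hj), sub_self, abs_zero]
      positivity
    by_cases hL : L = 0
    · rw [hL, pow_zero]
      exact abs_ratioCoord_sub_le_one (E.truncRatio_mem 0 C x) (ratio_mem C x)
    have hw : ∀ j, E.width C x j ≠ 0 := fun j hj => h ⟨j, hj⟩
    by_cases hocc : C.occ x = 0
    · have : IsEmpty (Fin (E.clauses C x).length) := by
        rw [E.length_clauses, hocc]; infer_instance
      rw [E.truncRatio_of_occ_eq_zero h (Or.inl hocc), E.ratio_recursion hC hw,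
        Finset.prod_of_isEmpty, sub_self, abs_zero]
      positivity
    rw [E.truncRatio_recursion h (not_or.mpr ⟨hocc, hL⟩), E.ratio_recursion hC hw]
    refine (ratioCoord_prod_lipschitz (δ := 0.981 ^ (L - 1)) ?_ ?_ ?_ (by positivity) ?_).trans ?_
    · rwa [Fintype.card_fin, E.length_clauses]
    · exact fun j => prod_div_one_add_mem_Ico (by rw [E.length_vars]; exact hw j)
        fun i => ratio_mem _ _
    · exact fun j => prod_div_one_add_mem_Ico (by rw [E.length_vars]; exact hw j)
        fun i => E.truncRatio_mem _ _ _
    · refine fun j => E.clauseCoord_error hC hw hL j fun i hi M hM => ih M hM _ _ hi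
        (fun y => (E.occ_subsub_le C x j i y).trans (hread y)) ?_
      exact Nat.le_of_lt_succ ((E.occ_subsub_get_lt C x j i).trans_le (hread _))
    · rw [← pow_succ', Nat.sub_add_cancel (Nat.pos_of_ne_zero hL)]

theorem ratio_error {C : Formula V} (hC : IsReadMonCNF 5 C) (x : V) (L : ℕ) :
    |E.truncRatio C x L - ratio C x| ≤ 5 * Real.sqrt 6 * (0.981 : ℝ) ^ L := by
  have hC0 : 0 ∉ C := fun h => hC.1 0 h rfl
  have h6 : (2.4 : ℝ) < Real.sqrt 6 := by
    rw [Real.lt_sqrt (by norm_num)]; norm_num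
  by_cases h : ∃ j, E.width C x j = 0
  · obtain ⟨j, hj⟩ := h
    rw [E.truncRatio_of_width_eq_zero ⟨j, hj⟩,
      ratio_eq_zero (Multiset.mem_filter.mp (E.get_mem_filter C x j)).1
        (E.pin_get_eq_zero C x hj), sub_self, abs_zero]
    positivity
  by_cases hL : L = 0
  · have h1 := E.truncRatio_mem L C x
    have h2 := ratio_mem C x
    rw [hL, pow_zero, ← hL, abs_le]
    constructor <;> linarith [h1.1, h1.2, h2.1, h2.2]
  have hw : ∀ j, E.width C x j ≠ 0 := fun j hj => h ⟨j, hj⟩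
  by_cases hocc : C.occ x = 0
  · have : IsEmpty (Fin (E.clauses C x).length) := by
      rw [E.length_clauses, hocc]; infer_instance
    rw [E.truncRatio_of_occ_eq_zero h (Or.inl hocc), E.ratio_recursion hC0 hw,
      Finset.prod_of_isEmpty, sub_self, abs_zero]
    positivity
  rw [E.truncRatio_recursion h (not_or.mpr ⟨hocc, hL⟩), E.ratio_recursion hC0 hw]
  refine (abs_prod_one_sub_sub_le (δ := 0.981 ^ (L - 1)) ?_ ?_ ?_).trans ?_
  · exact fun j => prod_div_one_add_mem_Ico (by rw [E.length_vars]; exact hw j)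
      fun i => ratio_mem _ _
  · exact fun j => prod_div_one_add_mem_Ico (by rw [E.length_vars]; exact hw j)
      fun i => E.truncRatio_mem _ _ _
  · refine fun j => E.clauseCoord_error hC0 hw hL j fun i hi M _ => E.ratioCoord_error M _ _ hi
      (fun y => (E.occ_subsub_le C x j i y).trans (hC.2 y)) ?_
    exact Nat.le_of_lt_succ ((E.occ_subsub_get_lt C x j i).trans_le (hC.2 _))
  -- Five clauses give the factor `10`, and `10 ≤ 5 √6 · 0.981` absorbs the shift from `L - 1` to
  -- `L`.
  · have hd : ((Fintype.card (Fin (E.clauses C x).length) : ℕ) : ℝ) ≤ 5 := by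
      rw [Fintype.card_fin, E.length_clauses]; exact_mod_cast hC.2 x
    have hp : (0 : ℝ) < 0.981 ^ (L - 1) := by positivity
    have e : (0.981 : ℝ) ^ L = 0.981 * 0.981 ^ (L - 1) := by
      rw [← pow_succ', Nat.sub_add_cancel (Nat.pos_of_ne_zero hL)]
    rw [e, ← mul_assoc]
    exact mul_le_mul_of_nonneg_right (by linarith) hp.le

end Enumeration

end MonCNF
theorem mainTheorem2 {V : Type*} [Fintype V] [DecidableEq V]
    (E : MonCNF.Enumeration V) (C : MonCNF.Formula V) (hC : MonCNF.IsReadMonCNF 5 C)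
    (x : V) (L : ℕ) :
    |E.truncRatio C x L - MonCNF.ratio C x| ≤ 5 * Real.sqrt 6 * (0.981 : ℝ) ^ L := by
  exact E.ratio_error hC x L
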